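/- Let $X$ be a real Hausdorff locally convex space, and let its topological dual $X^*$ carry the weak-star topology. Let $\Gamma_0(X)$ be the set of proper convex lower semicontinuous functions $X\to\mathbb{R}\cup\{+\infty\}$. For $\varphi\in\Gamma_0(X)$, $\varepsilon\ge 0$ and $x$ with $\varphi(x)<+\infty$, put $$\partial_\varepsilon\varphi(x)=\{x^*\in X^*:\ \varphi(y)\ge\varphi(x)+\langle x^*,y-x\rangle-\varepsilon\ \text{ for all } y\in X\}.$$ Let $T$ be a compact Hausdorff space, let $g\in\Gamma_0(X)$ and $f_t\in\Gamma_0(X)$ $(t\in T)$, and suppose that for every $z\in X$ the map $t\mapsto f_t(z)$ is upper semicontinuous on $T$. Consider the problem $$(\mathcal P)\qquad \inf\, g(x)\quad\text{subject to } f_t(x)\le 0,\ t\in T,$$ and let $\bar x$ be an optimal solution of $(\mathcal P)$ with $g(\bar x)<+\infty$. Let $T(\bar x)$ be the set of active indices, understood either as $\{t\in T: f_t(\bar x)=\sup_{s\in T}f_s(\bar x)\}$ or as $\{t\in T: f_t(\bar x)=0\}$ (the two sets coincide as soon as some constraint holds with equality at $\bar x$; the result holds for each of them). Let $0<\rho_t\le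 1$, $t\in T\setminus T(\bar x)$, be such that $$\inf_{t\in T\setminus T(\bar x)}\rho_t f_t(\bar x)>-\infty\qquad(\inf\emptyset=+\infty).$$ Then for every $\varepsilon>0$ and every neighborhood $U$ of $0$ in $X^*$ there are integers $m,n\ge 0$, with $m\ge1$ if $T(\bar x)\ne\emptyset$ and $n\ge1$ if $T\setminus T(\bar x)\neq\emptyset$, indices $t_1,\dots,t_m\in T(\bar x)$ and $t_{m+1},\dots,t_{m+n}\in T\setminus T(\bar x)$, and real numbers $\lambda_0,\dots,\lambda_{m+n}\ge 0$ with $\sum_{i=0}^{m+n}\lambda_i=1$, such that $$0\in\lambda_0\,\partial_\varepsilon g(\bar x)+\sum_{i=1}^{m}\lambda_i\,\partial_\varepsilon f_{t_i}(\bar x)+\sum_{i=m+1}^{m+n}\varepsilon\lambda_i\,\partial_\varepsilon(\rho_{t_i}f_{t_i})(\bar x)+U .$$ Moreover, if the Slater condition holds, i.e. there is $x_0\in X$ with $f_t(x_0)<0$ for all $t\in T$, then these indices and multipliers can be chosen with $\lambda_0>0$. -/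

import Mathlib

open Set Topology
open scoped Pointwise

noncomputable section

namespace ConvexSIP

/-- The class `Γ₀(X)`: proper, convex (convex epigraph), lower semicontinuous extended-real-valued
functions on `X`. -/
structure IsGammaZero {X : Type*} [AddCommGroup X] [Module ℝ X] [TopologicalSpace X]
    (φ : X → EReal) : Prop where
  exists_lt_top : ∃ x, φ x < ⊤
  bot_lt : ∀ x, ⊥ < φ x
  convex_epigraph : Convex ℝ {p : X × ℝ | φ p.1 ≤ (p.2 : EReal)}
  lowerSemicontinuous : LowerSemicontinuous φ

/-- The `ε`-subdifferential `∂_ε φ(x)`, a subset of the topological dual of `X` with its weak-star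
topology; it is empty when `φ x` is not a real number or `ε < 0`. -/
def epsSubdiff {X : Type*} [AddCommGroup X] [Module ℝ X] [TopologicalSpace X]
    (ε : ℝ) (φ : X → EReal) (x : X) : Set (WeakDual ℝ X) :=
  {ξ | 0 ≤ ε ∧ φ x ≠ ⊥ ∧ φ x ≠ ⊤ ∧ ∀ y, φ x + ((ξ (y - x) - ε : ℝ) : EReal) ≤ φ y}

/-- The function `r φ`, for a real number `r` (only used with `r > 0`). -/
def scale {X : Type*} (r : ℝ) (φ : X → EReal) : X → EReal :=
  fun x => (r : EReal) * φ x

/-- `x` satisfies all the constraints `f_t ≤ 0`, `t ∈ T`. -/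
def IsFeasible {X T : Type*} (f : T → X → EReal) (x : X) : Prop :=
  ∀ t, f t x ≤ 0

/-- `x` is an optimal solution of the problem `inf g(x)` subject to `f_t(x) ≤ 0`, `t ∈ T`: it is
feasible, the objective is finite there, and no feasible point has a smaller objective value. -/
structure IsOptimalSolution {X T : Type*} (g : X → EReal) (f : T → X → EReal) (x : X) : Prop where
  feasible : IsFeasible f x
  lt_top : g x < ⊤
  le_of_feasible : ∀ y, IsFeasible f y → g x ≤ g y

/-- The indices at which the supremum function `sup_t f_t` is attained at `x`. -/
def activeSet {X T : Type*} (f : T → X → EReal) (x : X) : Set T :=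
  {t | f t x = ⨆ s, f s x}

/-- The indices of the constraints `f_t ≤ 0` that hold as equalities at `x`. -/
def bindingSet {X T : Type*} (f : T → X → EReal) (x : X) : Set T :=
  {t | f t x = 0}

/-- The Slater condition. -/
def Slater {X T : Type*} (f : T → X → EReal) : Prop :=
  ∃ x₀, ∀ t, f t x₀ < 0

end ConvexSIP

end

namespace ConvexSIP

/-! ### Approximate subgradients and separation. -/

section Subdifferential

variable {X : Type*} [AddCommGroup X] [Module ℝ X] [TopologicalSpace X]
  {φ : X → EReal} {x : X} {c ε : ℝ}

/-! It suffices to put `0` in the weak-star closure of the convex hull of all the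
`ε`-subdifferentials involved. Otherwise Hahn-Banach yields a direction `z` on which all these
subgradients are at most some `-α < 0`. A function that never falls below its value at the base
point along the ray has an `ε`-subgradient almost nonnegative on `z`
(`IsGammaZero.exists_mem_epsSubdiff`), so `g` drops somewhere on the ray and each `f_t` becomes
negative somewhere on it. By compactness and convexity short steps along `z` are feasible and lower
`g`, against optimality (`IsOptimalSolution.not_exists_direction`).

The slack `U` then allows a small move towards a point of `∂_ε g`, which makes its multiplier
positive. -/

theorem coe_le_of_forall_real_le {a : ℝ} {b : EReal} (hb : b ≠ ⊥)
    (h : ∀ v : ℝ, b ≤ v → a ≤ v) : (a : EReal) ≤ b := by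
  induction b with
  | bot => exact absurd rfl hb
  | coe r => exact_mod_cast h r le_rfl
  | top => exact le_top

/-- Membership in the `ε`-subdifferential, tested on the epigraph. -/
theorem mem_epsSubdiff_iff (hbot : ∀ y, ⊥ < φ y) (hx : φ x = c) {ξ : WeakDual ℝ X} :
    ξ ∈ epsSubdiff ε φ x ↔ 0 ≤ ε ∧ ∀ y (v : ℝ), φ y ≤ v → c + ξ (y - x) - ε ≤ v := by
  constructor
  · rintro ⟨h0, -, -, h⟩
    refine ⟨h0, fun y v hv => ?_⟩
    have := (h y).trans hv
    rw [hx, ← EReal.coe_add, EReal.coe_le_coe_iff] at this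
    linarith
  · rintro ⟨h0, h⟩
    refine ⟨h0, by simp [hx], by simp [hx], fun y => ?_⟩
    rw [hx, ← EReal.coe_add]
    refine coe_le_of_forall_real_le (hbot y).ne' fun v hv => ?_
    linarith [h y v hv]

theorem convex_epsSubdiff (hbot : ∀ y, ⊥ < φ y) (hx : φ x = c) :
    Convex ℝ (epsSubdiff ε φ x) := by
  intro ξ hξ η hη a b ha hb hab
  rw [mem_epsSubdiff_iff hbot hx] at hξ hη ⊢
  refine ⟨hξ.1, fun y v hv => ?_⟩
  have h1 := mul_le_mul_of_nonneg_left (hξ.2 y v hv) ha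
  have h2 := mul_le_mul_of_nonneg_left (hη.2 y v hv) hb
  change c + (a * ξ (y - x) + b * η (y - x)) - ε ≤ v
  obtain rfl : b = 1 - a := by linarith
  nlinarith

/-- `ρ ∂_{ε/ρ} φ(x) ⊆ ∂_ε (ρφ)(x)` for `ρ > 0`. -/
theorem smul_mem_epsSubdiff_scale (hbot : ∀ y, ⊥ < φ y) (hx : φ x = c) {ρ : ℝ} (hρ : 0 < ρ)
    {ξ : WeakDual ℝ X} (hξ : ξ ∈ epsSubdiff (ε / ρ) φ x) :
    ρ • ξ ∈ epsSubdiff ε (scale ρ φ) x := by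
  rw [mem_epsSubdiff_iff hbot hx] at hξ
  have hε : 0 ≤ ε := by
    have := mul_nonneg hξ.1 hρ.le
    rwa [div_mul_cancel₀ _ hρ.ne'] at this
  have hsx : scale ρ φ x = ((ρ * c : ℝ) : EReal) := by simp [scale, hx]
  refine ⟨hε, by rw [hsx]; exact EReal.coe_ne_bot _, by rw [hsx]; exact EReal.coe_ne_top _,
    fun y => ?_⟩
  rw [hsx, ← EReal.coe_add]
  change _ ≤ (ρ : EReal) * φ y
  change ((ρ * c + (ρ * ξ (y - x) - ε) : ℝ) : EReal) ≤ _
  have hy := hbot y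
  have h := hξ.2 y
  generalize φ y = b at hy h
  induction b with
  | bot => exact absurd hy (lt_irrefl _)
  | top => rw [EReal.coe_mul_top_of_pos hρ]; exact le_top
  | coe r =>
    have := mul_le_mul_of_nonneg_left (h r le_rfl) hρ.le
    rw [← EReal.coe_mul, EReal.coe_le_coe_iff]
    have e : ρ * (ε / ρ) = ε := mul_div_cancel₀ _ hρ.ne'
    nlinarith

theorem IsGammaZero.isClosed_epigraph (hφ : IsGammaZero φ) :
    IsClosed {p : X × ℝ | φ p.1 ≤ (p.2 : EReal)} :=
  hφ.lowerSemicontinuous.isClosed_epigraph.preimage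
    (f := fun p : X × ℝ => (p.1, (p.2 : EReal)))
    (continuous_fst.prodMk (continuous_coe_real_ereal.comp continuous_snd))

/-- A convex set of functionals that meets every closed half-space `{ξ | -α ≤ ξ z}`, `α > 0`, has
`0` in its weak-star closure. -/
theorem zero_mem_closure_of_forall_exists {C : Set (WeakDual ℝ X)} (hC : Convex ℝ C)
    (h : ∀ (z : X) (α : ℝ), 0 < α → ∃ ξ ∈ C, -α ≤ ξ z) : (0 : WeakDual ℝ X) ∈ closure C := by
  by_contra h0
  have : LocallyConvexSpace ℝ (WeakDual ℝ X) :=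
    inferInstanceAs (LocallyConvexSpace ℝ (WeakBilin (topDualPairing ℝ X)))
  obtain ⟨F, u, hu, hu0⟩ := geometric_hahn_banach_closed_point hC.closure isClosed_closure h0
  -- A weak-star continuous functional is evaluation at a point of `X`.
  obtain ⟨z, hz⟩ := LinearMap.dualEmbedding_surjective (topDualPairing ℝ X) F
  have hF : ∀ ξ : WeakDual ℝ X, F ξ = ξ z := fun ξ => (DFunLike.congr_fun hz ξ).symm
  have hu1 : u < 0 := by simpa using hu0
  obtain ⟨ξ, hξ, hle⟩ := h z (-u) (by linarith)
  have := hu ξ (subset_closure hξ)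
  rw [hF] at this
  linarith

variable [IsTopologicalAddGroup X] [ContinuousSMul ℝ X] [LocallyConvexSpace ℝ X]

/-- If `φ` does not decrease from `x` in the direction `z`, then its `ε`-subgradients at `x` are not
uniformly negative on `z`. -/
theorem IsGammaZero.exists_mem_epsSubdiff (hφ : IsGammaZero φ) (hx : φ x = c) (hε : 0 < ε) {z : X}
    (hz : ∀ s : ℝ, 0 < s → (c : EReal) ≤ φ (x + s • z)) {α : ℝ} (hα : 0 < α) :
    ∃ ξ ∈ epsSubdiff ε φ x, -α ≤ ξ z := by
  -- Over a segment of this length a vertical gap `ε` costs slope `α`.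
  set S : ℝ := ε / α with hS
  have hS0 : 0 < S := div_pos hε hα
  have hK : segment ℝ (x, c - ε) (x + S • z, c - ε) =
      (fun s : ℝ => (x + s • S • z, c - ε)) '' Icc (0 : ℝ) 1 := by
    rw [segment_eq_image']
    refine image_congr fun s _ => ?_
    simp
  have hKc : IsCompact (segment ℝ (x, c - ε) (x + S • z, c - ε)) := by
    rw [hK]
    exact isCompact_Icc.image (by fun_prop)
  have hdisj : Disjoint (segment ℝ (x, c - ε) (x + S • z, c - ε))
      {p : X × ℝ | φ p.1 ≤ (p.2 : EReal)} := by
    rw [hK, Set.disjoint_left]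
    rintro _ ⟨s, hs, rfl⟩ h
    have hle : (c : EReal) ≤ φ (x + s • S • z) := by
      rcases hs.1.eq_or_lt with rfl | h0
      · simp [hx]
      · rw [smul_smul]
        exact hz _ (mul_pos h0 hS0)
    have h' := hle.trans h
    rw [EReal.coe_le_coe_iff] at h'
    linarith
  obtain ⟨F, u, v, hu, huv, hv⟩ := geometric_hahn_banach_compact_closed
    (convex_segment _ _) hKc hφ.convex_epigraph hφ.isClosed_epigraph hdisj
  set r : ℝ := F (0, 1) with hr
  set ζ : X →L[ℝ] ℝ := F.comp (ContinuousLinearMap.inl ℝ X ℝ) with hζ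
  have hF : ∀ (y : X) (t : ℝ), F (y, t) = ζ y + t * r := by
    intro y t
    have : (y, t) = (y, (0 : ℝ)) + t • ((0 : X), (1 : ℝ)) := by simp
    rw [this, map_add, map_smul]
    simp [hζ, hr]
  have h1 : ζ x + (c - ε) * r < u := hF x (c - ε) ▸ hu _ (left_mem_segment ℝ _ _)
  have h2 : ζ x + S * ζ z + (c - ε) * r < u := by
    have := hu _ (right_mem_segment ℝ (x, c - ε) (x + S • z, c - ε))
    rwa [hF, map_add, map_smul, smul_eq_mul] at this
  have h3 : ∀ (y : X) (t : ℝ), φ y ≤ t → v < ζ y + t * r := fun y t h => hF y t ▸ hv (y, t) h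
  have h4 := h3 x c hx.le
  -- The hyperplane passes strictly between `(x, c - ε)` and `(x, c)`, so it is not vertical.
  have hr0 : 0 < r := by
    by_contra hcon
    nlinarith
  have hri : 0 < r⁻¹ := inv_pos.2 hr0
  have hrr : r⁻¹ * r = 1 := inv_mul_cancel₀ hr0.ne'
  refine ⟨((-r⁻¹) • ζ : X →L[ℝ] ℝ), (mem_epsSubdiff_iff hφ.bot_lt hx).2 ⟨hε.le, fun y t h => ?_⟩, ?_⟩
  · change c + (-r⁻¹) * ζ (y - x) - ε ≤ t
    rw [map_sub]
    have h5 : ζ x + (c - ε) * r < ζ y + t * r := by linarith [h3 y t h]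
    have h6 := mul_lt_mul_of_pos_left h5 hri
    linear_combination h6.le - (c - ε - t) * hrr
  · change -α ≤ (-r⁻¹) * ζ z
    have h5 : S * ζ z < ε * r := by linarith
    have h6 : ζ z < α * r := by
      rw [hS, div_mul_eq_mul_div, div_lt_iff₀ hα] at h5
      nlinarith
    have h7 := mul_lt_mul_of_pos_left h6 hri
    linear_combination h7.le + α * hrr

theorem IsGammaZero.epsSubdiff_nonempty (hφ : IsGammaZero φ) (hx : φ x = c) (hε : 0 < ε) :
    (epsSubdiff ε φ x).Nonempty := by
  obtain ⟨ξ, hξ, -⟩ := hφ.exists_mem_epsSubdiff hx hε (z := 0) (by simp [hx]) one_pos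
  exact ⟨ξ, hξ⟩

theorem IsGammaZero.exists_mem_epsSubdiff_scale (hφ : IsGammaZero φ) (hx : φ x = c) (hε : 0 < ε)
    {ρ : ℝ} (hρ : 0 < ρ) {z : X} (hz : ∀ s : ℝ, 0 < s → (c : EReal) ≤ φ (x + s • z)) {α : ℝ}
    (hα : 0 < α) : ∃ ξ ∈ epsSubdiff ε (scale ρ φ) x, -α ≤ ξ z := by
  obtain ⟨ξ, hξ, h⟩ := hφ.exists_mem_epsSubdiff hx (div_pos hε hρ) hz (div_pos hα hρ)
  refine ⟨ρ • ξ, smul_mem_epsSubdiff_scale hφ.bot_lt hx hρ hξ, ?_⟩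
  change -α ≤ ρ * ξ z
  have := mul_le_mul_of_nonneg_left h hρ.le
  have e : ρ * (α / ρ) = α := mul_div_cancel₀ _ hρ.ne'
  linarith

theorem IsGammaZero.epsSubdiff_scale_nonempty (hφ : IsGammaZero φ) (hx : φ x = c) (hε : 0 < ε)
    {ρ : ℝ} (hρ : 0 < ρ) : (epsSubdiff ε (scale ρ φ) x).Nonempty := by
  obtain ⟨ξ, hξ, -⟩ := hφ.exists_mem_epsSubdiff_scale hx hε hρ (z := 0) (by simp [hx]) one_pos
  exact ⟨ξ, hξ⟩

end Subdifferential

/-! ### Descent directions and feasibility. -/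

section Feasibility

variable {X : Type*} [AddCommGroup X] [Module ℝ X] [TopologicalSpace X] {φ : X → EReal}

theorem IsGammaZero.apply_add_smul_le (hφ : IsGammaZero φ) {x z : X} {a b s θ : ℝ}
    (ha : φ x ≤ a) (hb : φ (x + s • z) ≤ b) (hθ : θ ∈ Icc (0 : ℝ) 1) :
    φ (x + (θ * s) • z) ≤ ((a + θ * (b - a) : ℝ) : EReal) := by
  have := hφ.convex_epigraph.add_smul_sub_mem (x := (x, a)) (y := (x + s • z, b)) ha hb hθ
  simpa [smul_smul] using this

/-- Negativity at one step persists for nearby indices by upper semicontinuity; convexity and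
feasibility of `x` extend `≤ 0` to all shorter steps. Compactness makes the step uniform. -/
theorem exists_pos_forall_le_zero {T : Type*} [TopologicalSpace T] [CompactSpace T]
    {f : T → X → EReal} (hf : ∀ t, IsGammaZero (f t))
    (husc : ∀ y, UpperSemicontinuous (fun t => f t y)) {x z : X} (hx : IsFeasible f x)
    (h : ∀ t, ∃ s : ℝ, 0 < s ∧ f t (x + s • z) < 0) :
    ∃ s : ℝ, 0 < s ∧ ∀ t, ∀ s' : ℝ, 0 < s' → s' ≤ s → f t (x + s' • z) ≤ 0 := by
  suffices H : ∃ s : ℝ, 0 < s ∧ ∀ t ∈ (univ : Set T), ∀ s' : ℝ, 0 < s' → s' ≤ s →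
      f t (x + s' • z) ≤ 0 by simpa using H
  refine isCompact_univ.induction_on (p := fun V => ∃ s : ℝ, 0 < s ∧ ∀ t ∈ V, ∀ s' : ℝ, 0 < s' →
      s' ≤ s → f t (x + s' • z) ≤ 0) ⟨1, one_pos, by simp⟩ ?_ ?_ ?_
  · rintro V W hVW ⟨s, hs, H⟩
    exact ⟨s, hs, fun t ht => H t (hVW ht)⟩
  · rintro V W ⟨s, hs, H⟩ ⟨s', hs', H'⟩
    refine ⟨min s s', lt_min hs hs', fun t ht q hq hq' => ?_⟩
    rcases ht with ht | ht
    · exact H t ht q hq (hq'.trans (min_le_left _ _))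
    · exact H' t ht q hq (hq'.trans (min_le_right _ _))
  · intro t _
    obtain ⟨s, hs, hlt⟩ := h t
    refine ⟨_, mem_nhdsWithin_of_mem_nhds (husc (x + s • z) t 0 hlt), s, hs,
      fun τ hτ s' hs' hle => ?_⟩
    have hθ : s' / s ∈ Icc (0 : ℝ) 1 := ⟨(div_pos hs' hs).le, (div_le_one hs).2 hle⟩
    have hτ' : f τ (x + s • z) ≤ ((0 : ℝ) : EReal) := by
      have : f τ (x + s • z) < 0 := hτ
      simpa using this.le
    have := (hf τ).apply_add_smul_le (a := 0) (by simpa using hx τ) hτ' hθ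
    rw [div_mul_cancel₀ _ hs.ne'] at this
    simpa using this

/-- At an optimal solution no direction strictly decreases the objective and makes each of the
constraints strictly negative. -/
theorem IsOptimalSolution.not_exists_direction {T : Type*} [TopologicalSpace T] [CompactSpace T]
    {g : X → EReal} {f : T → X → EReal} (hg : IsGammaZero g) (hf : ∀ t, IsGammaZero (f t))
    (husc : ∀ y, UpperSemicontinuous (fun t => f t y)) {x : X} (hopt : IsOptimalSolution g f x)
    {z : X} {s₀ : ℝ} (hs₀ : 0 < s₀) (hg₀ : g (x + s₀ • z) < g x)
    (h : ∀ t, ∃ s : ℝ, 0 < s ∧ f t (x + s • z) < 0) : False := by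
  obtain ⟨s, hs, H⟩ := exists_pos_forall_le_zero hf husc hopt.feasible h
  obtain ⟨r, hr, hr'⟩ := EReal.lt_iff_exists_real_btwn.1 hg₀
  lift g x to ℝ using ⟨hopt.lt_top.ne, (hg.bot_lt x).ne'⟩ with c hc
  have hq : 0 < min s s₀ := lt_min hs hs₀
  have hθ0 : 0 < min s s₀ / s₀ := div_pos hq hs₀
  have hle := hg.apply_add_smul_le hc.ge hr.le
    (θ := min s s₀ / s₀) ⟨hθ0.le, (div_le_one hs₀).2 (min_le_right _ _)⟩
  rw [div_mul_cancel₀ _ hs₀.ne'] at hle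
  have hfeas := hopt.le_of_feasible _ fun t => H t _ hq (min_le_left _ _)
  have h1 := hfeas.trans hle
  rw [← hc, EReal.coe_le_coe_iff] at h1
  rw [EReal.coe_lt_coe_iff] at hr'
  nlinarith

end Feasibility

/-! ### Regrouping convex combinations. -/

section Combinations

variable {E : Type*} [AddCommGroup E] [Module ℝ E]

theorem sum_smul_mem_smul {C : Set E} (hC : Convex ℝ C) (hne : C.Nonempty) {ι : Type*}
    (I : Finset ι) {w : ι → ℝ} {z : ι → E} (hw : ∀ i ∈ I, 0 ≤ w i) (hz : ∀ i ∈ I, z i ∈ C) :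
    ∑ i ∈ I, w i • z i ∈ (∑ i ∈ I, w i) • C := by
  classical
  induction I using Finset.induction_on with
  | empty => simp [zero_smul_set hne]
  | insert a I ha ih =>
    rw [Finset.sum_insert ha, Finset.sum_insert ha, hC.add_smul (hw a (by simp))
      (Finset.sum_nonneg fun i hi => hw i (by simp [hi]))]
    exact add_mem_add (smul_mem_smul_set (hz a (by simp)))
      (ih (fun i hi => hw i (by simp [hi])) fun i hi => hz i (by simp [hi]))

/-- A finite nonnegative combination of points of the sets `D t`, `t ∈ B`, can be indexed by
`Fin m`, with `m ≥ 1` as soon as `B` is nonempty. -/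
theorem exists_fin_sum_smul_mem {T : Type*} {B : Set T} {D : T → Set E}
    (hD : ∀ t ∈ B, (D t).Nonempty) {ι : Type*} (I : Finset ι) {w : ι → ℝ} {z : ι → E}
    (hw : ∀ i ∈ I, 0 ≤ w i) (hz : ∀ i ∈ I, ∃ t ∈ B, z i ∈ D t) :
    ∃ (m : ℕ) (s : Fin m → T) (l : Fin m → ℝ), (B.Nonempty → 1 ≤ m) ∧ (∀ i, s i ∈ B) ∧
      (∀ i, 0 ≤ l i) ∧ ∑ i, l i = ∑ i ∈ I, w i ∧
      ∑ i ∈ I, w i • z i ∈ ∑ i, l i • D (s i) := by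
  classical
  induction I using Finset.induction_on with
  | empty =>
    rcases B.eq_empty_or_nonempty with hB | ⟨t, ht⟩
    · exact ⟨0, Fin.elim0, Fin.elim0, by simp [hB], by simp, by simp, by simp, by simp⟩
    -- A dummy index with weight zero secures `m ≥ 1`; it contributes `{0}` because `D t` is
    -- nonempty.
    · exact ⟨1, fun _ => t, fun _ => 0, by simp, by simpa using ht, by simp, by simp,
        by simp [zero_smul_set (hD t ht)]⟩
  | insert a I ha ih =>
    obtain ⟨m, s, l, -, hs, hl, hsum, hmem⟩ := ih (fun i hi => hw i (by simp [hi]))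
      fun i hi => hz i (by simp [hi])
    obtain ⟨t, ht, hzt⟩ := hz a (by simp)
    refine ⟨m + 1, Fin.cons t s, Fin.cons (w a) l, by simp, ?_, ?_, ?_, ?_⟩
    · exact Fin.cases ht hs
    · exact Fin.cases (hw a (by simp)) hl
    · rw [Fin.sum_univ_succ, Finset.sum_insert ha]
      simp [hsum]
    · rw [Fin.sum_univ_succ, Finset.sum_insert ha]
      simp only [Fin.cons_zero, Fin.cons_succ]
      exact add_mem_add (smul_mem_smul_set hzt) hmem

/-- A point of the convex hull of `G`, the `D t`, `t ∈ A`, and the `H t`, `t ∉ A`, moved towards a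
point of `G`, as a combination of points of these sets. -/
theorem exists_combination_of_mem_convexHull {T : Type*} {A : Set T} {G : Set E} {D H : T → Set E}
    (hG : Convex ℝ G) (hD : ∀ t ∈ A, (D t).Nonempty) (hH : ∀ t ∈ Aᶜ, (H t).Nonempty) {p a : E}
    (hp : p ∈ convexHull ℝ (G ∪ (⋃ t ∈ A, D t) ∪ ⋃ t ∈ Aᶜ, H t)) (ha : a ∈ G)
    {η : ℝ} (hη : 0 < η) (hη1 : η ≤ 1) :
    ∃ (m n : ℕ) (s : Fin m → T) (r : Fin n → T) (l₀ : ℝ) (l : Fin m → ℝ) (k : Fin n → ℝ),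
      (A.Nonempty → 1 ≤ m) ∧ (Aᶜ.Nonempty → 1 ≤ n) ∧ (∀ i, s i ∈ A) ∧ (∀ j, r j ∈ Aᶜ) ∧
      0 < l₀ ∧ (∀ i, 0 ≤ l i) ∧ (∀ j, 0 ≤ k j) ∧ l₀ + ∑ i, l i + ∑ j, k j = 1 ∧
      p + η • (a - p) ∈ l₀ • G + ∑ i, l i • D (s i) + ∑ j, k j • H (r j) := by
  classical
  obtain ⟨ι, _, w, z, hw, hw1, hz, rfl⟩ := mem_convexHull_iff_exists_fintype.1 hp
  -- Scaling by `1 - η` leaves weight `η` for `a`.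
  set v : ι → ℝ := fun i => (1 - η) * w i with hv
  have hv0 : ∀ i, 0 ≤ v i := fun i => mul_nonneg (by linarith) (hw i)
  have hv1 : ∑ i, v i = 1 - η := by rw [← Finset.mul_sum, hw1, mul_one]
  set P : Finset ι := {i | z i ∈ G} with hP
  set P' : Finset ι := {i | z i ∉ G} with hP'
  set Q : Finset ι := P'.filter fun i => ∃ t ∈ A, z i ∈ D t with hQ
  set R : Finset ι := P'.filter fun i => ¬ ∃ t ∈ A, z i ∈ D t with hR
  have hsum : ∑ i, v i = ∑ i ∈ P, v i + ∑ i ∈ Q, v i + ∑ i ∈ R, v i := by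
    rw [add_assoc, Finset.sum_filter_add_sum_filter_not, Finset.sum_filter_add_sum_filter_not]
  have hcomb : ∑ i, v i • z i = ∑ i ∈ P, v i • z i + ∑ i ∈ Q, v i • z i + ∑ i ∈ R, v i • z i := by
    rw [add_assoc, Finset.sum_filter_add_sum_filter_not, Finset.sum_filter_add_sum_filter_not]
  have hPmem := sum_smul_mem_smul hG ⟨a, ha⟩ P (w := v) (z := z) (fun i _ => hv0 i)
    fun i hi => (Finset.mem_filter.1 hi).2
  obtain ⟨m, s, l, hm, hs, hl, hls, hlmem⟩ := exists_fin_sum_smul_mem hD Q (w := v) (z := z)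
    (fun i _ => hv0 i) fun i hi => (Finset.mem_filter.1 hi).2
  obtain ⟨n, r, k, hn, hr, hk, hks, hkmem⟩ := exists_fin_sum_smul_mem hH R (w := v) (z := z)
    (fun i _ => hv0 i) fun i hi => by
      obtain ⟨hi', hiD⟩ := Finset.mem_filter.1 hi
      rcases hz i with (h | h) | h
      · exact absurd h (Finset.mem_filter.1 hi').2
      · exact absurd (by simpa using h) hiD
      · simpa using h
  have hP0 : 0 ≤ ∑ i ∈ P, v i := Finset.sum_nonneg fun i _ => hv0 i
  refine ⟨m, n, s, r, η + ∑ i ∈ P, v i, l, k, hm, hn, hs, hr, by linarith, hl, hk, by linarith, ?_⟩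
  have hpt : ∑ i, w i • z i + η • (a - ∑ i, w i • z i) =
      η • a + ∑ i ∈ P, v i • z i + ∑ i ∈ Q, v i • z i + ∑ i ∈ R, v i • z i := by
    have : ∑ i, v i • z i = (1 - η) • ∑ i, w i • z i := by
      rw [Finset.smul_sum]
      exact Finset.sum_congr rfl fun i _ => mul_smul _ _ _
    rw [add_assoc, add_assoc, ← add_assoc (∑ i ∈ P, v i • z i), ← hcomb, this]
    module
  rw [hpt, hG.add_smul hη.le hP0]
  exact add_mem_add (add_mem_add (add_mem_add (smul_mem_smul_set ha) hPmem) hlmem) hkmem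

end Combinations

end ConvexSIP

open ConvexSIP in
theorem mainTheorem9
    {X : Type*} [AddCommGroup X] [Module ℝ X] [TopologicalSpace X] [IsTopologicalAddGroup X]
    [ContinuousSMul ℝ X] [LocallyConvexSpace ℝ X] [T2Space X]
    {T : Type*} [TopologicalSpace T] [CompactSpace T] [T2Space T]
    (g : X → EReal) (f : T → X → EReal)
    (hg : ConvexSIP.IsGammaZero g) (hf : ∀ t, ConvexSIP.IsGammaZero (f t))
    (husc : ∀ z, UpperSemicontinuous (fun t => f t z))
    (xbar : X) (hopt : ConvexSIP.IsOptimalSolution g f xbar)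
    -- the active index set at `xbar`, in either of its two usual meanings
    (A : Set T) (hA : A = ConvexSIP.activeSet f xbar ∨ A = ConvexSIP.bindingSet f xbar)
    (ρ : T → ℝ) (hρ : ∀ t ∈ Aᶜ, 0 < ρ t ∧ ρ t ≤ 1)
    (hρinf : ⊥ < ⨅ t ∈ Aᶜ, ConvexSIP.scale (ρ t) (f t) xbar)
    (ε : ℝ) (hε : 0 < ε) (U : Set (WeakDual ℝ X)) (hU : U ∈ 𝓝 (0 : WeakDual ℝ X)) :
    ∃ (m n : ℕ) (s : Fin m → T) (r : Fin n → T) (l₀ : ℝ) (l : Fin m → ℝ) (k : Fin n → ℝ),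
      (A.Nonempty → 1 ≤ m) ∧ (Aᶜ.Nonempty → 1 ≤ n) ∧
      (∀ i, s i ∈ A) ∧ (∀ j, r j ∈ Aᶜ) ∧
      0 ≤ l₀ ∧ (∀ i, 0 ≤ l i) ∧ (∀ j, 0 ≤ k j) ∧ l₀ + ∑ i, l i + ∑ j, k j = 1 ∧
      (0 : WeakDual ℝ X) ∈
        l₀ • ConvexSIP.epsSubdiff ε g xbar
          + ∑ i, l i • ConvexSIP.epsSubdiff ε (f (s i)) xbar
          + ∑ j, (ε * k j) • ConvexSIP.epsSubdiff ε (ConvexSIP.scale (ρ (r j)) (f (r j))) xbar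
          + U ∧
      (ConvexSIP.Slater f → 0 < l₀) := by
  have hgx : ∃ c : ℝ, g xbar = c := by
    lift g xbar to ℝ using ⟨hopt.lt_top.ne, (hg.bot_lt xbar).ne'⟩ with c
    exact ⟨c, rfl⟩
  have hfx : ∀ t, ∃ c : ℝ, f t xbar = c := fun t => by
    have h0 : f t xbar ≠ ⊤ := ((hopt.feasible t).trans_lt EReal.zero_lt_top).ne
    lift f t xbar to ℝ using ⟨h0, ((hf t).bot_lt xbar).ne'⟩ with c
    exact ⟨c, rfl⟩
  obtain ⟨c, hc⟩ := hgx
  choose d hd using hfx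
  have hd0 : ∀ t, f t xbar ≤ 0 := hopt.feasible
  set G : Set (WeakDual ℝ X) := epsSubdiff ε g xbar with hG
  set D : T → Set (WeakDual ℝ X) := fun t => epsSubdiff ε (f t) xbar with hD
  -- With `ε` absorbed into the sets, the multipliers are plain convex weights.
  set H : T → Set (WeakDual ℝ X) := fun t => ε • epsSubdiff ε (scale (ρ t) (f t)) xbar with hH
  set C : Set (WeakDual ℝ X) := convexHull ℝ (G ∪ (⋃ t ∈ A, D t) ∪ ⋃ t ∈ Aᶜ, H t) with hC
  have hcl : (0 : WeakDual ℝ X) ∈ closure C := by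
    refine zero_mem_closure_of_forall_exists (convex_convexHull ℝ _) fun z α hα => ?_
    by_contra! hneg
    have hnegG : ∀ ξ ∈ G, ξ z < -α := fun ξ hξ =>
      hneg ξ (subset_convexHull ℝ _ (Or.inl (Or.inl hξ)))
    have hnegD : ∀ t ∈ A, ∀ ξ ∈ D t, ξ z < -α := fun t ht ξ hξ =>
      hneg ξ (subset_convexHull ℝ _ (Or.inl (Or.inr (mem_biUnion ht hξ))))
    have hnegH : ∀ t ∈ Aᶜ, ∀ ξ ∈ H t, ξ z < -α := fun t ht ξ hξ =>
      hneg ξ (subset_convexHull ℝ _ (Or.inr (mem_biUnion ht hξ)))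
    have hdec : ∃ s : ℝ, 0 < s ∧ g (xbar + s • z) < g xbar := by
      by_contra! hcon
      obtain ⟨ξ, hξ, hle⟩ := hg.exists_mem_epsSubdiff hc hε (fun s hs => hc ▸ hcon s hs) hα
      exact (hnegG ξ hξ).not_ge hle
    obtain ⟨s₀, hs₀, hlt⟩ := hdec
    refine hopt.not_exists_direction hg hf husc hs₀ hlt fun t => ?_
    by_contra! hcon
    have hz : ∀ s : ℝ, 0 < s → (d t : EReal) ≤ f t (xbar + s • z) := fun s hs =>
      (hd t ▸ hd0 t).trans (hcon s hs)
    by_cases ht : t ∈ A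
    · obtain ⟨ξ, hξ, hle⟩ := (hf t).exists_mem_epsSubdiff (hd t) hε hz hα
      exact (hnegD t ht ξ hξ).not_ge hle
    · obtain ⟨ξ, hξ, hle⟩ := (hf t).exists_mem_epsSubdiff_scale (hd t) hε (hρ t ht).1 hz
        (div_pos hα hε)
      have h1 : ε * ξ z < -α := hnegH t ht (ε • ξ) (smul_mem_smul_set hξ)
      have h2 := mul_le_mul_of_nonneg_left hle hε.le
      have e : ε * (α / ε) = α := mul_div_cancel₀ _ hε.ne'
      linarith
  -- The inner quantifier leaves room to perturb `p`; the sign is there since `0 = ζ + (-ζ)`.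
  have hU' : ∀ᶠ ξ in 𝓝 (0 : WeakDual ℝ X), ∀ᶠ ζ in 𝓝 ξ, -ζ ∈ U :=
    eventually_eventually_nhds.2 (continuous_neg.tendsto' _ _ neg_zero hU)
  obtain ⟨p, hpU, hpC⟩ := mem_closure_iff_nhds.1 hcl _ hU'
  obtain ⟨a, ha⟩ : G.Nonempty := hg.epsSubdiff_nonempty hc hε
  have hlim : Filter.Tendsto (fun η : ℝ => p + η • (a - p)) (𝓝[>] 0) (𝓝 p) :=
    tendsto_nhdsWithin_of_tendsto_nhds ((by fun_prop : Continuous fun η : ℝ =>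
      p + η • (a - p)).tendsto' _ _ (by simp))
  obtain ⟨η, hηU, hη⟩ := ((hlim.eventually hpU).and (Ioc_mem_nhdsGT one_pos)).exists
  obtain ⟨m, n, s, r, l₀, l, k, hm, hn, hs, hr, hl₀, hl, hk, hsum, hmem⟩ :=
    exists_combination_of_mem_convexHull (A := A) (D := D) (H := H)
      (convex_epsSubdiff hg.bot_lt hc) (fun t _ => (hf t).epsSubdiff_nonempty (hd t) hε)
      (fun t ht => ((hf t).epsSubdiff_scale_nonempty (hd t) hε (hρ t ht).1).smul_set)
      hpC ha hη.1 hη.2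
  refine ⟨m, n, s, r, l₀, l, k, hm, hn, hs, hr, hl₀.le, hl, hk, hsum, ?_, fun _ => hl₀⟩
  have hsmul : ∀ j, k j • H (r j) =
      (ε * k j) • epsSubdiff ε (scale (ρ (r j)) (f (r j))) xbar := fun j => by
    rw [hH, smul_smul, mul_comm]
  simp only [hsmul] at hmem
  exact ⟨_, hmem, _, hηU, add_neg_cancel _⟩
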